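/- Let $p,q\ge 1$ and let $\mathrm d\mu=(\mathrm d\mu_{b,a})$, $1\le b\le q$, $1\le a\le p$, be a $q\times p$ matrix of complex (in particular, finite signed or positive) Borel measures on $\mathbb R$ with finite moments of all orders. For $n\in\mathbb N_0$ let the mixed multiple orthogonal polynomials $B_n^{(b)},A_n^{(a)}\in\mathbb C[x]$ be such that * the coefficient of $x^k$ in $B_n^{(b)}$ is $0$ if $kq+b-1>n$ and $1$ if $kq+b-1=n$; * the coefficient of $x^k$ in $A_n^{(a)}$ is $0$ if $kp+a-1>n$ and nonzero if $kp+a-1=n$; * $\displaystyle\sum_{b=1}^q\sum_{a=1}^p\int_{\mathbb R}B_n^{(b)}(x)\,\mathrm d\mu_{b,a}(x)\,A_m^{(a)}(x)=\delta_{n,m}$ for all $n,m\in\mathbb N_0$. (Equivalently, $B=SX_{[q]}$ and $A=X_{[p]}^\top U$, where $X_{[s]}=(I_s,xI_s,x^2I_s,\dots)^\top$ and $\mathscr M=S^{-1}U^{-1}$ is the Gauss–Borel factorization of the moment matrix $\mathscr M=\int X_{[q]}\,\mathrm d\mu\,X_{[p]}^\top$, with $S$ lower unitriangular and $U$ upper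 triangular and nonsingular.) We say that mixed multiple orthogonality exists for a $q\times p$ matrix of measures if it has finite moments and there are polynomials satisfying these conditions for it. Let $N\ge1$, $0\le r<p$, and let $R(x)=\sum_{l=0}^NR_lx^l$, $R_l\in\mathbb C^{p\times p}$, be a matrix polynomial with $$R_N=\begin{bmatrix}0_{(p-r)\times r}&I_{p-r}\\0_{r\times r}&0_{r\times(p-r)}\end{bmatrix},\qquad R_{N-1}=\begin{bmatrix}*_{(p-r)\times r}&*_{(p-r)\times(p-r)}\\I_{r}&*_{r\times(p-r)}\end{bmatrix},$$ where $*$ denotes arbitrary blocks; then $\det R$ has degree $Np-r$. Let $x_1,\dots,x_M$ be the distinct zeros of $\det R$. For each $x_i$ let row vectors $\boldsymbol v_{i,j,k}\in\mathbb C^p$, $1\le j\le s_i$, $0\le k<\kappa_{i,j}$ (with $\kappa_{i,j}\ge1$) form a canonical set of left Jordan chains of $R$ at $x_i$, that is: $$\sum_{l=0}^{k}\frac1{l!}\,\boldsymbol v_{i,j,k-l}\,R^{(l)}(x_i)=0\qquad(0\le k<\kappa_{i,j}),$$ the vectors $\boldsymbol v_{i,1,0},\dots,\boldsymbol v_{i,s_i,0}$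 are linearly independent, and $\sum_{j}\kappa_{i,j}$ is the multiplicity of $x_i$ as a zero of $\det R$. Put $$\mathbb A_n^{(i,j,k)}=\sum_{l=0}^{k}\frac1{l!}\sum_{a=1}^p(\boldsymbol v_{i,j,k-l})_a\,\frac{\mathrm d^lA_n^{(a)}}{\mathrm dx^l}(x_i),$$ and let $\tau_n$ be the determinant of the square matrix of size $Np-r$ whose rows are indexed by the triples $(i,j,k)$ in lexicographic order and whose row $(i,j,k)$ is $\bigl(\mathbb A_n^{(i,j,k)},\mathbb A_{n+1}^{(i,j,k)},\dots,\mathbb A_{n+Np-r-1}^{(i,j,k)}\bigr)$. Then mixed multiple orthogonality exists for the perturbed matrix of measures $\mathrm d\mu(x)\,R(x)$ if and only if $\tau_n\ne0$ for every $n\in\mathbb N_0$. -/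

import Mathlib

open scoped Polynomial

noncomputable section

namespace MixedMOP

open MeasureTheory

/-- A `q × p` matrix of (complex Borel) measures on the real line. -/
abbrev MeasureMatrix (q p : ℕ) := Matrix (Fin q) (Fin p) (ComplexMeasure ℝ)

/-- The integral `∫ f(x) dν(x)` of a polynomial against a complex measure on the real line. -/
def polyIntegral (ν : ComplexMeasure ℝ) (f : ℂ[X]) : ℂ :=
  ν.integral (fun x : ℝ => f.eval (x : ℂ)) (ContinuousLinearMap.mul ℝ ℂ)

/-- All moments of all entries are finite (absolutely convergent). -/
def HasFiniteMoments {q p : ℕ} (μ : MeasureMatrix q p) : Prop :=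
  ∀ (b : Fin q) (a : Fin p) (k : ℕ), (μ b a).Integrable (fun x : ℝ => (x : ℂ) ^ k)

/-- The perturbed matrix of measures `dμ R`, whose `(b, a)` entry is `∑_c R_{c,a}(x) dμ_{b,c}(x)`. -/
def perturb {q p : ℕ} (μ : MeasureMatrix q p) (R : Matrix (Fin p) (Fin p) ℂ[X]) :
    MeasureMatrix q p :=
  fun b a => ∑ c : Fin p, (μ b c).withDensity
    (fun x : ℝ => (R c a).eval (x : ℂ)) (ContinuousLinearMap.mul ℝ ℂ)

/-- `B n b` is `B_n^{(b)}` and `A n a` is `A_n^{(a)}` (superscripts counted from `0`): they are the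
mixed multiple orthogonal polynomials of `μ`, in the normalization where the `B` are monic.

The position `k * q + b` is that of `x ^ k e_b` in the column `(I_q, x I_q, x² I_q, …)`. So the
first two fields say `B = S X_{[q]}` with `S` lower unitriangular, the next two say
`A = X_{[p]}ᵀ U` with `U` upper triangular and nonsingular, and the last one is `∫ B dμ A = I`, that
is `S ℳ U = I` for the moment matrix `ℳ` (its Gauss-Borel factorization). -/
structure IsMixedOrthogonal {q p : ℕ} (μ : MeasureMatrix q p)
    (B : ℕ → Fin q → ℂ[X]) (A : ℕ → Fin p → ℂ[X]) : Prop where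
  B_coeff_eq_zero : ∀ (n : ℕ) (b : Fin q) (k : ℕ), n < k * q + b → (B n b).coeff k = 0
  B_coeff_eq_one : ∀ (n : ℕ) (b : Fin q) (k : ℕ), n = k * q + b → (B n b).coeff k = 1
  A_coeff_eq_zero : ∀ (n : ℕ) (a : Fin p) (k : ℕ), n < k * p + a → (A n a).coeff k = 0
  A_coeff_ne_zero : ∀ (n : ℕ) (a : Fin p) (k : ℕ), n = k * p + a → (A n a).coeff k ≠ 0
  biorthogonal : ∀ n m : ℕ,
    ∑ b : Fin q, ∑ a : Fin p, polyIntegral (μ b a) (B n b * A m a) = if n = m then 1 else 0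

/-- Mixed multiple orthogonality exists for the matrix of measures `μ`. -/
def HasMixedOrthogonality {q p : ℕ} (μ : MeasureMatrix q p) : Prop :=
  HasFiniteMoments μ ∧
    ∃ (B : ℕ → Fin q → ℂ[X]) (A : ℕ → Fin p → ℂ[X]), IsMixedOrthogonal μ B A

/-- The shape of the perturbation `R(x) = ∑_{l ≤ N} R_l x^l`: in block form
`R_N = [0, I_{p-r}; 0, 0]` and `R_{N-1} = [*, *; I_r, *]`, where the rows are split as
`(p - r) + r` and the columns as `r + (p - r)`. -/
structure IsPerturbation {p : ℕ} (N r : ℕ) (R : Matrix (Fin p) (Fin p) ℂ[X]) : Prop where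
  natDegree_le : ∀ i j, (R i j).natDegree ≤ N
  leading : ∀ i j : Fin p, (R i j).coeff N = if (j : ℕ) = i + r then 1 else 0
  subleading : ∀ i j : Fin p, p - r ≤ (i : ℕ) → (j : ℕ) < r →
    (R i j).coeff (N - 1) = if (i : ℕ) = j + (p - r) then 1 else 0

/-- The value at `z` of the `l`-th derivative of a matrix polynomial. -/
def derivEval {p : ℕ} (R : Matrix (Fin p) (Fin p) ℂ[X]) (l : ℕ) (z : ℂ) :
    Matrix (Fin p) (Fin p) ℂ :=
  R.map fun f => (Polynomial.derivative^[l] f).eval z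

/-- The row vectors `v 0, …, v (κ - 1)` satisfy the relations of a left Jordan chain of length `κ`
of `R` at `z`. -/
def IsJordanChain {p : ℕ} (R : Matrix (Fin p) (Fin p) ℂ[X]) (z : ℂ) (κ : ℕ)
    (v : ℕ → Fin p → ℂ) : Prop :=
  ∀ i < κ, ∑ l ∈ Finset.range (i + 1),
    ((l.factorial : ℂ)⁻¹) • Matrix.vecMul (v (i - l)) (derivEval R l z) = 0

/-- A finite family of points `point i`, and at each of them finitely many chains of row vectors:
the `j`-th chain at `point i` consists of `vec i j k`, `k < len i j`. -/
structure ChainSystem (p : ℕ) where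
  numPoints : ℕ
  point : Fin numPoints → ℂ
  numChains : Fin numPoints → ℕ
  len : (i : Fin numPoints) → Fin (numChains i) → ℕ
  vec : (i : Fin numPoints) → Fin (numChains i) → ℕ → Fin p → ℂ

/-- The points are the distinct zeros of `det R`, and the chains at each of them form a canonical
set of left Jordan chains of `R`: the leading vectors are linearly independent and the lengths
add up to the multiplicity of the zero. -/
structure ChainSystem.IsCanonical {p : ℕ} (J : ChainSystem p)
    (R : Matrix (Fin p) (Fin p) ℂ[X]) : Prop where
  point_injective : Function.Injective J.point
  isRoot_iff : ∀ z : ℂ, R.det.IsRoot z ↔ ∃ i, J.point i = z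
  len_pos : ∀ i j, 0 < J.len i j
  isJordanChain : ∀ i j, IsJordanChain R (J.point i) (J.len i j) (J.vec i j)
  linearIndependent : ∀ i, LinearIndependent ℂ fun j => J.vec i j 0
  sum_len : ∀ i, ∑ j, J.len i j = R.det.rootMultiplicity (J.point i)

/-- The total number of vectors. For a canonical system it is the number of zeros of `det R` counted
with multiplicity. -/
def ChainSystem.size {p : ℕ} (J : ChainSystem p) : ℕ := ∑ i, ∑ j, J.len i j

/-- The enumeration of all triples (point, chain, position in the chain), in lexicographic
order. -/
def ChainSystem.enum {p : ℕ} (J : ChainSystem p) :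
    ((i : Fin J.numPoints) × (j : Fin (J.numChains i)) × Fin (J.len i j)) ≃ Fin J.size :=
  (Equiv.sigmaCongrRight fun _ => finSigmaFinEquiv).trans finSigmaFinEquiv

/-- `∑_{l ≤ k} (1 / l!) ∑_a v_{k-l,a} (d^l f_a / dx^l)(z)`: a column of polynomials evaluated along
a chain of row vectors. -/
def chainEval {p : ℕ} (z : ℂ) (v : ℕ → Fin p → ℂ) (k : ℕ) (f : Fin p → ℂ[X]) : ℂ :=
  ∑ l ∈ Finset.range (k + 1), ((l.factorial : ℂ)⁻¹) *
    ∑ a : Fin p, v (k - l) a * (Polynomial.derivative^[l] (f a)).eval z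

/-- The determinant `τ_n`. Its columns are the evaluations of `A_n, A_{n+1}, …` along all
chains. -/
def tau {p : ℕ} (A : ℕ → Fin p → ℂ[X]) (J : ChainSystem p) (n : ℕ) : ℂ :=
  Matrix.det (Matrix.of fun (u c : Fin J.size) =>
    let w := J.enum.symm u
    chainEval (J.point w.1) (J.vec w.1 w.2.1) w.2.2 (A (n + c)))

end MixedMOP

end

open scoped Polynomial

noncomputable section

namespace MixedMOP

open MeasureTheory

/-! ### Integration against a complex measure with a density. -/

section Integral

/-! Mixed orthogonality is a Gauss–Borel factorization of the pairing `∫ B dμ A`. It exists iff no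
nonzero column among the first `n` positions is orthogonal to the first `n` rows, for every `n`
(`exists_isBiorthogonal_iff`). Replacing `μ` by `μ R` composes the pairing with the map `T : g ↦ R
g` (`momentPairing_perturb`). The shape of `R` makes `T` raise leading positions by exactly `D = N p
- r` (`IsPerturbation.isShift`), so `T` is injective and its range has codimension `D`. Evaluations
along the Jordan chains kill this range, are linearly independent, and number `deg det R = D`. Hence
a column has the form `R g` iff all of them vanish on it (`IsShift.mem_range_iff`).

Suppose `g` is a degenerate vector of the perturbed pairing at level `n`. Then `R g` lies in level
`n + D` and is orthogonal to the first `n` rows, so it is a combination of `A_n, …, A_{n+D-1}` on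
which all chain functionals vanish. Conversely, a nonzero combination of these that the functionals
kill is some `R g`, and comparing leading positions puts `g` in level `n`. Such a combination exists
iff `τ_n = 0` (`IsBiorthogonal.exists_comp_shift_iff`). -/

theorem integral_const_mul {ν : ComplexMeasure ℝ} (c : ℂ) (f : ℝ → ℂ) :
    ν.integral (fun x => c * f x) (ContinuousLinearMap.mul ℝ ℂ) =
      c * ν.integral f (ContinuousLinearMap.mul ℝ ℂ) := by
  rw [VectorMeasure.integral_eq_setToFun, VectorMeasure.integral_eq_setToFun]
  exact setToFun_smul _ (fun c s x => by
    simp [VectorMeasure.transpose]; ring) c f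

theorem variation_withDensity_mul {ν : ComplexMeasure ℝ} {f : ℝ → ℂ} (hf : ν.Integrable f) :
    (ν.withDensity f (ContinuousLinearMap.mul ℝ ℂ)).variation =
      ν.variation.withDensity fun x => ‖f x‖ₑ := by
  rw [VectorMeasure.variation_withDensity hf (by simp),
    VectorMeasure.variation_transpose_eq _ _ (by simp)]

theorem Integrable.mul_of_withDensity {ν : ComplexMeasure ℝ} {f g : ℝ → ℂ}
    (hf : ν.Integrable f) (hfm : Measurable f)
    (hg : (ν.withDensity f (ContinuousLinearMap.mul ℝ ℂ)).Integrable g) :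
    ν.Integrable fun x => f x * g x := by
  unfold VectorMeasure.Integrable at hg ⊢
  rw [variation_withDensity_mul hf,
    integrable_withDensity_iff_integrable_smul' hfm.enorm (by simp)] at hg
  refine hg.mono ?_ (by simp)
  -- Measurability is known only for `‖f‖ g`; multiplying by the phase `f / ‖f‖` recovers `f g`, and
  -- both vanish where `f = 0`.
  have hm : AEStronglyMeasurable (fun x => f x * ((‖f x‖⁻¹ : ℝ) : ℂ)) ν.variation :=
    (hfm.mul (Complex.measurable_ofReal.comp hfm.norm.inv)).aestronglyMeasurable
  refine (hm.mul hg.aestronglyMeasurable).congr (.of_forall fun x => ?_)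
  by_cases h : f x = 0
  · simp [h]
  · have : (‖f x‖ : ℂ) ≠ 0 := by simpa using h
    simp
    field_simp

theorem Integrable.withDensity_of_mul {ν : ComplexMeasure ℝ} {f g : ℝ → ℂ}
    (hf : ν.Integrable f) (hfm : Measurable f) (hgm : Measurable g)
    (hg : ν.Integrable fun x => f x * g x) :
    (ν.withDensity f (ContinuousLinearMap.mul ℝ ℂ)).Integrable g := by
  unfold VectorMeasure.Integrable at hg ⊢
  rw [variation_withDensity_mul hf,
    integrable_withDensity_iff_integrable_smul' hfm.enorm (by simp)]
  refine hg.mono ?_ (by simp)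
  exact (hfm.enorm.ennreal_toReal.smul hgm).aestronglyMeasurable

/-- Integration against a complex measure with a density. -/
theorem integral_withDensity_mul {ν : ComplexMeasure ℝ} {f g : ℝ → ℂ}
    (hf : ν.Integrable f) (hfm : Measurable f)
    (hg : (ν.withDensity f (ContinuousLinearMap.mul ℝ ℂ)).Integrable g) :
    (ν.withDensity f (ContinuousLinearMap.mul ℝ ℂ)).integral g (ContinuousLinearMap.mul ℝ ℂ) =
      ν.integral (fun x => f x * g x) (ContinuousLinearMap.mul ℝ ℂ) := by
  set ρ := ν.withDensity f (ContinuousLinearMap.mul ℝ ℂ) with hρ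
  refine Integrable.induction (μ := ρ.variation) (fun g => ρ.integral g (ContinuousLinearMap.mul ℝ ℂ)
    = ν.integral (fun x => f x * g x) (ContinuousLinearMap.mul ℝ ℂ)) ?_ ?_ ?_ ?_ hg
  · intro c s hs hlt
    have h1 : (fun x => f x * s.indicator (fun _ => c) x) =
        s.indicator fun x => c * f x := by
      ext x
      by_cases hx : x ∈ s <;> simp [hx, mul_comm]
    have : IsFiniteMeasure (ρ.restrict s).variation := by
      rw [VectorMeasure.variation_restrict hs]
      exact ⟨by simpa using hlt⟩
    rw [h1, VectorMeasure.integral_indicator hs, VectorMeasure.integral_indicator hs,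
      integral_const_mul, VectorMeasure.integral_const, VectorMeasure.restrict_apply _ hs .univ,
      Set.univ_inter, hρ, VectorMeasure.withDensity_apply hf]
    rfl
  · intro g h _ hg hh ihg ihh
    have e : (fun x => f x * (g + h) x) = fun x => f x * g x + f x * h x := by
      ext x
      simp [mul_add]
    rw [e, VectorMeasure.integral_fun_add (Integrable.mul_of_withDensity hf hfm hg)
      (Integrable.mul_of_withDensity hf hfm hh), VectorMeasure.integral_add hg hh, ihg, ihh]
  · refine isClosed_eq VectorMeasure.continuous_integral ?_
    -- The `L¹` distance for the variation of the density measure is `∫ ‖f‖ ‖g - h‖` against the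
    -- variation of `ν`, so `g ↦ ∫ f g dν` is Lipschitz on that `L¹` space.
    refine (LipschitzWith.continuous (K := ‖ContinuousLinearMap.mul ℝ ℂ‖₊) fun g h => ?_)
    refine (VectorMeasure.edist_integral_le_lintegral_edist
      (Integrable.mul_of_withDensity hf hfm (L1.integrable_coeFn g))
      (Integrable.mul_of_withDensity hf hfm (L1.integrable_coeFn h))).trans_eq ?_
    rw [L1.edist_def, enorm_eq_nnnorm]
    congr 1
    have hlint (d : ℝ → ENNReal) (hd : Measurable d) :
        ∫⁻ x, d x ∂ρ.variation = ∫⁻ x, ‖f x‖ₑ * d x ∂ν.variation := by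
      rw [variation_withDensity_mul hf, lintegral_withDensity_eq_lintegral_mul _ hfm.enorm hd]
      rfl
    rw [hlint _ ((Lp.stronglyMeasurable g).measurable.edist (Lp.stronglyMeasurable h).measurable)]
    refine lintegral_congr fun x => ?_
    simp only [edist_eq_enorm_sub, ← mul_sub, enorm_mul]
  · intro g h hgh _ ih
    rw [← VectorMeasure.integral_congr_ae hgh, ih]
    refine VectorMeasure.integral_congr_ae ?_
    -- Almost everywhere equality for the density measure says nothing where `f = 0`, but there the
    -- product with `f` vanishes anyway.
    rw [variation_withDensity_mul hf, Filter.EventuallyEq,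
      ae_withDensity_iff hfm.enorm] at hgh
    filter_upwards [hgh] with x hx
    by_cases h0 : f x = 0
    · simp [h0]
    · rw [hx (by simpa using h0)]

end Integral

/-! ### The moment pairing and its perturbation. -/

section Moments

variable {p q : ℕ}

theorem measurable_eval_ofReal (f : ℂ[X]) : Measurable fun x : ℝ => f.eval (x : ℂ) :=
  (f.continuous.comp Complex.continuous_ofReal).measurable

theorem HasFiniteMoments.integrable {μ : MeasureMatrix q p} (hμ : HasFiniteMoments μ)
    (b : Fin q) (a : Fin p) (f : ℂ[X]) : (μ b a).Integrable fun x : ℝ => f.eval (x : ℂ) := by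
  simp only [Polynomial.eval_eq_sum_range]
  exact VectorMeasure.Integrable.fun_finsetSum _ fun k _ =>
    MeasureTheory.Integrable.const_mul (hμ b a k) _

theorem integrable_perturb_entry {μ : MeasureMatrix q p} (hμ : HasFiniteMoments μ)
    (b : Fin q) (c : Fin p) (f g : ℂ[X]) :
    ((μ b c).withDensity (fun x : ℝ => f.eval (x : ℂ)) (ContinuousLinearMap.mul ℝ ℂ)).Integrable
      fun x : ℝ => g.eval (x : ℂ) :=
  Integrable.withDensity_of_mul (hμ.integrable b c f) (measurable_eval_ofReal f)
    (measurable_eval_ofReal g) (by simpa using hμ.integrable b c (f * g))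

theorem HasFiniteMoments.perturb {μ : MeasureMatrix q p} (hμ : HasFiniteMoments μ)
    (R : Matrix (Fin p) (Fin p) ℂ[X]) : HasFiniteMoments (perturb μ R) := fun b a k =>
  VectorMeasure.Integrable.finsetSum_vectorMeasure fun c _ => by
    simpa using integrable_perturb_entry hμ b c (R c a) (Polynomial.X ^ k)

theorem polyIntegral_perturb {μ : MeasureMatrix q p} (hμ : HasFiniteMoments μ)
    (R : Matrix (Fin p) (Fin p) ℂ[X]) (b : Fin q) (a : Fin p) (g : ℂ[X]) :
    polyIntegral (MixedMOP.perturb μ R b a) g = ∑ c, polyIntegral (μ b c) (R c a * g) := by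
  unfold polyIntegral MixedMOP.perturb
  rw [VectorMeasure.integral_finsetSum_vectorMeasure fun c _ =>
    integrable_perturb_entry hμ b c (R c a) g]
  refine Finset.sum_congr rfl fun c _ => ?_
  rw [integral_withDensity_mul (hμ.integrable b c _) (measurable_eval_ofReal _)
    (integrable_perturb_entry hμ b c (R c a) g)]
  simp

theorem HasFiniteMoments.polyIntegral_add {μ : MeasureMatrix q p} (hμ : HasFiniteMoments μ)
    (b : Fin q) (a : Fin p) (f g : ℂ[X]) :
    polyIntegral (μ b a) (f + g) = polyIntegral (μ b a) f + polyIntegral (μ b a) g := by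
  simp only [polyIntegral, Polynomial.eval_add]
  exact VectorMeasure.integral_fun_add (hμ.integrable b a f) (hμ.integrable b a g)

theorem polyIntegral_smul (ν : ComplexMeasure ℝ) (c : ℂ) (f : ℂ[X]) :
    polyIntegral ν (c • f) = c * polyIntegral ν f := by
  simp only [polyIntegral, Polynomial.eval_smul, smul_eq_mul]
  exact integral_const_mul c _

/-- The integral of polynomials against an entry of a matrix of measures, as a linear map. -/
def entryIntegral {μ : MeasureMatrix q p} (hμ : HasFiniteMoments μ) (b : Fin q) (a : Fin p) :
    ℂ[X] →ₗ[ℂ] ℂ where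
  toFun := polyIntegral (μ b a)
  map_add' := hμ.polyIntegral_add b a
  map_smul' := polyIntegral_smul (μ b a)

/-- The pairing `∫ B dμ A` of a row `B` and a column `A` of polynomials. -/
def momentPairing {μ : MeasureMatrix q p} (hμ : HasFiniteMoments μ) :
    (Fin q → ℂ[X]) →ₗ[ℂ] (Fin p → ℂ[X]) →ₗ[ℂ] ℂ :=
  LinearMap.mk₂ ℂ (fun B A => ∑ b, ∑ a, entryIntegral hμ b a (B b * A a))
    (fun _ _ _ => by simp [add_mul, Finset.sum_add_distrib])
    (fun _ _ _ => by simp [Finset.mul_sum])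
    (fun _ _ _ => by simp [mul_add, Finset.sum_add_distrib])
    (fun _ _ _ => by simp [Finset.mul_sum])

theorem momentPairing_apply {μ : MeasureMatrix q p} (hμ : HasFiniteMoments μ)
    (B : Fin q → ℂ[X]) (A : Fin p → ℂ[X]) :
    momentPairing hμ B A = ∑ b, ∑ a, polyIntegral (μ b a) (B b * A a) := rfl

/-- Multiplication of columns of polynomials by a matrix polynomial, as a linear map over `ℂ`. -/
def mulColumn (R : Matrix (Fin p) (Fin p) ℂ[X]) : (Fin p → ℂ[X]) →ₗ[ℂ] (Fin p → ℂ[X]) :=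
  R.mulVecLin.restrictScalars ℂ

theorem mulColumn_apply (R : Matrix (Fin p) (Fin p) ℂ[X]) (f : Fin p → ℂ[X]) :
    mulColumn R f = R.mulVec f := rfl

/-- Reduces the perturbation to linear algebra: the measures now matter only through the original
pairing. -/
theorem momentPairing_perturb {μ : MeasureMatrix q p} (hμ : HasFiniteMoments μ)
    (R : Matrix (Fin p) (Fin p) ℂ[X]) :
    momentPairing (hμ.perturb R) = (momentPairing hμ).compl₂ (mulColumn R) := by
  refine LinearMap.ext₂ fun B A => ?_
  rw [LinearMap.compl₂_apply, momentPairing_apply]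
  change _ = ∑ b, ∑ c, entryIntegral hμ b c (B b * R.mulVec A c)
  refine Finset.sum_congr rfl fun b _ => ?_
  simp only [Matrix.mulVec, dotProduct, Finset.mul_sum, map_sum, polyIntegral_perturb hμ]
  rw [Finset.sum_comm]
  refine Finset.sum_congr rfl fun c _ => Finset.sum_congr rfl fun a _ => ?_
  rw [mul_left_comm]
  rfl

end Moments

/-! ### Gauss–Borel factorization and shifts on filtered spaces. -/

section Filtration

variable {K V W : Type*} [Field K] [AddCommGroup V] [Module K V] [AddCommGroup W] [Module K W]

/-- The span of the first `n` vectors of a basis indexed by `ℕ`. -/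
def lowerSpan (b : Module.Basis ℕ K V) (n : ℕ) : Submodule K V where
  carrier := {v | ∀ m, n ≤ m → b.repr v m = 0}
  zero_mem' := by simp
  add_mem' := fun hv hw m hm => by simp [hv m hm, hw m hm]
  smul_mem' := fun c v hv m hm => by simp [hv m hm]

theorem lowerSpan_mono (b : Module.Basis ℕ K V) {m n : ℕ} (h : m ≤ n) :
    lowerSpan b m ≤ lowerSpan b n :=
  fun _ hv k hk => hv k (h.trans hk)

theorem basis_mem_lowerSpan (b : Module.Basis ℕ K V) {m n : ℕ} (h : m < n) :
    b m ∈ lowerSpan b n := fun k hk => by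
  rw [b.repr_self, Finsupp.single_eq_of_ne (by omega)]

theorem exists_mem_lowerSpan (b : Module.Basis ℕ K V) (v : V) : ∃ n, v ∈ lowerSpan b n := by
  refine ⟨(b.repr v).support.sup id + 1, fun m hm => ?_⟩
  by_contra h
  have := Finset.le_sup (f := id) (Finsupp.mem_support_iff.2 h)
  simp only [id] at this
  omega

theorem mem_lowerSpan_of_succ {b : Module.Basis ℕ K V} {n : ℕ} {v : V}
    (hv : v ∈ lowerSpan b (n + 1)) (h : b.repr v n = 0) : v ∈ lowerSpan b n := fun m hm => by
  rcases hm.eq_or_lt with rfl | hm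
  · exact h
  · exact hv m hm

theorem eq_zero_of_mem_lowerSpan_zero {b : Module.Basis ℕ K V} {v : V}
    (hv : v ∈ lowerSpan b 0) : v = 0 := by
  apply b.repr.injective
  ext m
  simpa using hv m (Nat.zero_le m)

/-- A family that is triangular with respect to the basis spans the filtration. -/
theorem exists_sum_of_triangular {b : Module.Basis ℕ K V} {A : ℕ → V}
    (hA : ∀ n, A n ∈ lowerSpan b (n + 1)) (hA' : ∀ n, b.repr (A n) n ≠ 0) (n : ℕ) :
    ∀ v ∈ lowerSpan b n, ∃ c : ℕ → K, v = ∑ i ∈ Finset.range n, c i • A i := by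
  induction n with
  | zero => exact fun v hv => ⟨0, by simpa using eq_zero_of_mem_lowerSpan_zero hv⟩
  | succ n ih =>
    intro v hv
    set a := b.repr v n / b.repr (A n) n with ha
    have hw : v - a • A n ∈ lowerSpan b n := by
      refine mem_lowerSpan_of_succ (sub_mem hv (Submodule.smul_mem _ _ (hA n))) ?_
      simp [ha, hA' n]
    obtain ⟨c, hc⟩ := ih _ hw
    refine ⟨Function.update c n a, ?_⟩
    rw [Finset.sum_range_succ, Function.update_self, ← sub_eq_iff_eq_add, hc]
    refine Finset.sum_congr rfl fun i hi => ?_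
    rw [Function.update_of_ne (Finset.mem_range.1 hi).ne]

theorem sum_mem_lowerSpan (b : Module.Basis ℕ K V) {n : ℕ} (x : Fin n → K) :
    ∑ i, x i • b i ∈ lowerSpan b n :=
  sum_mem fun i _ => Submodule.smul_mem _ _ (basis_mem_lowerSpan b i.2)

theorem repr_sum_fin (b : Module.Basis ℕ K V) {n : ℕ} (x : Fin n → K) (i : Fin n) :
    b.repr (∑ j, x j • b j) i = x i := by
  simp [Finsupp.single_apply, Fin.val_inj]

theorem exists_sum_fin {b : Module.Basis ℕ K V} {n : ℕ} {v : V} (hv : v ∈ lowerSpan b n) :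
    ∃ x : Fin n → K, v = ∑ i, x i • b i := by
  obtain ⟨c, hc⟩ := exists_sum_of_triangular (A := b) (b := b)
    (fun n => basis_mem_lowerSpan b n.lt_succ_self) (by simp) n v hv
  exact ⟨fun i => c i, by rw [hc, Finset.sum_range]⟩

/-- Triangular families `B`, `A` (the first one with unit diagonal) that are dual to each other with
respect to a pairing. -/
structure IsBiorthogonal (bW : Module.Basis ℕ K W) (bV : Module.Basis ℕ K V)
    (L : W →ₗ[K] V →ₗ[K] K) (B : ℕ → W) (A : ℕ → V) : Prop where
  left_mem : ∀ n, B n ∈ lowerSpan bW (n + 1)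
  left_diag : ∀ n, bW.repr (B n) n = 1
  right_mem : ∀ n, A n ∈ lowerSpan bV (n + 1)
  right_diag : ∀ n, bV.repr (A n) n ≠ 0
  pairing : ∀ n m, L (B n) (A m) = if n = m then 1 else 0

variable {bW : Module.Basis ℕ K W} {bV : Module.Basis ℕ K V} {L : W →ₗ[K] V →ₗ[K] K}

/-- The first `n` vectors `A i` span level `n`, and the dual vectors `B i` read off the
coefficients. -/
theorem IsBiorthogonal.expansion {B : ℕ → W} {A : ℕ → V} (h : IsBiorthogonal bW bV L B A)
    {n : ℕ} {v : V} (hv : v ∈ lowerSpan bV n) :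
    v = ∑ i ∈ Finset.range n, L (B i) v • A i := by
  obtain ⟨c, hc⟩ := exists_sum_of_triangular h.right_mem h.right_diag n v hv
  conv_lhs => rw [hc]
  refine Finset.sum_congr rfl fun i hi => ?_
  congr 1
  rw [hc, map_sum, Finset.sum_eq_single i]
  · simp [h.pairing]
  · intro j _ hj
    simp [h.pairing, hj.symm]
  · exact fun hi' => absurd hi hi'

/-- By triangularity the first `n` vectors `B j` and the first `n` basis vectors have the same span.
-/
theorem IsBiorthogonal.apply_eq_zero_iff {B : ℕ → W} {A : ℕ → V} (h : IsBiorthogonal bW bV L B A)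
    (n : ℕ) (v : V) : (∀ j < n, L (bW j) v = 0) ↔ ∀ j < n, L (B j) v = 0 := by
  constructor
  · intro hv j hj
    obtain ⟨x, hx⟩ := exists_sum_fin (h.left_mem j)
    rw [hx, map_sum, LinearMap.sum_apply]
    refine Finset.sum_eq_zero fun i _ => ?_
    rw [map_smul, LinearMap.smul_apply, hv i (by omega), smul_zero]
  · intro hv j hj
    obtain ⟨c, hc⟩ := exists_sum_of_triangular h.left_mem (fun n => by simp [h.left_diag]) n _
      (basis_mem_lowerSpan bW hj)
    rw [hc, map_sum, LinearMap.sum_apply]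
    refine Finset.sum_eq_zero fun i hi => ?_
    rw [map_smul, LinearMap.smul_apply, hv i (Finset.mem_range.1 hi), smul_zero]

/-- Existence of the Gauss-Borel factorization: it is equivalent to the nondegeneracy of the pairing
on all pairs of subspaces of the two filtrations. -/
theorem exists_isBiorthogonal_iff :
    (∃ B A, IsBiorthogonal bW bV L B A) ↔
      ∀ n, ∀ v ∈ lowerSpan bV n, (∀ j < n, L (bW j) v = 0) → v = 0 := by
  constructor
  · rintro ⟨B, A, h⟩ n v hv hL
    rw [h.apply_eq_zero_iff] at hL
    rw [h.expansion hv]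
    exact Finset.sum_eq_zero fun i hi => by rw [hL i (Finset.mem_range.1 hi), zero_smul]
  · intro h
    -- The leading blocks of the moment matrix; the hypothesis says that each is invertible.
    let M (n : ℕ) : Matrix (Fin n) (Fin n) K := Matrix.of fun i j => L (bW i) (bV j)
    have hMv (n : ℕ) (x : Fin n → K) (i : Fin n) :
        (M n).mulVec x i = L (bW i) (∑ j, x j • bV j) := by
      simp [M, Matrix.mulVec, dotProduct, mul_comm]
    have hvM (n : ℕ) (x : Fin n → K) (j : Fin n) :
        Matrix.vecMul x (M n) j = L (∑ i, x i • bW i) (bV j) := by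
      simp [M, Matrix.vecMul, dotProduct]
    have hunit (n : ℕ) : IsUnit (M n) := by
      rw [← Matrix.mulVec_injective_iff_isUnit]
      refine (injective_iff_map_eq_zero (M n).mulVecLin).2 fun x hx => ?_
      have := h n _ (sum_mem_lowerSpan bV x) fun j hj => by
        rw [← hMv n x ⟨j, hj⟩]
        exact congrFun hx _
      ext i
      rw [← repr_sum_fin bV x i, this]
      simp
    -- `bW n - w n` will be `B n`: the correction `w n` makes it orthogonal to level `n`. Dually, `A
    -- n` below solves the block system of size `n + 1` with the last unit vector on the right.
    have hB (n : ℕ) : ∃ w ∈ lowerSpan bW n, ∀ j < n, L w (bV j) = L (bW n) (bV j) := by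
      obtain ⟨x, hx⟩ := (Matrix.vecMul_surjective_iff_isUnit.2 (hunit n))
        fun j => L (bW n) (bV j)
      exact ⟨_, sum_mem_lowerSpan bW x, fun j hj => (hvM n x ⟨j, hj⟩).symm.trans (congrFun hx _)⟩
    have hA (n : ℕ) : ∃ v ∈ lowerSpan bV (n + 1),
        ∀ i < n + 1, L (bW i) v = if i = n then 1 else 0 := by
      obtain ⟨x, hx⟩ := (Matrix.mulVec_surjective_iff_isUnit.2 (hunit (n + 1)))
        fun i => if (i : ℕ) = n then 1 else 0
      exact ⟨_, sum_mem_lowerSpan bV x, fun i hi => by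
        rw [← hMv (n + 1) x ⟨i, hi⟩, hx]⟩
    choose w hw hwL using hB
    choose A hAm hAL using hA
    have hzero (n : ℕ) (u : W) (hu : u ∈ lowerSpan bW n) : L u (A n) = 0 := by
      obtain ⟨x, rfl⟩ := exists_sum_fin hu
      rw [map_sum, LinearMap.sum_apply]
      refine Finset.sum_eq_zero fun i _ => ?_
      rw [map_smul, LinearMap.smul_apply, hAL n i (by omega), if_neg (by omega), smul_zero]
    have hmem (n : ℕ) : bW n - w n ∈ lowerSpan bW (n + 1) :=
      sub_mem (basis_mem_lowerSpan bW n.lt_succ_self) (lowerSpan_mono bW n.le_succ (hw n))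
    refine ⟨fun n => bW n - w n, A, hmem, fun n => by simp [hw n n le_rfl], hAm, fun n hn => ?_,
      fun n m => ?_⟩
    -- Without its leading term, `A n` would be a degenerate vector of level `n`, hence zero,
    -- against `L (bW n) (A n) = 1`.
    · have := h n (A n) (mem_lowerSpan_of_succ (hAm n) hn) fun j hj => by
        rw [hAL n j (by omega), if_neg hj.ne]
      have h1 := hAL n n n.lt_succ_self
      simp [this] at h1
    · rcases lt_trichotomy n m with hnm | rfl | hnm
      · rw [if_neg hnm.ne, hzero m _ (lowerSpan_mono bW hnm (hmem n))]
      · rw [if_pos rfl, map_sub, LinearMap.sub_apply, hAL n n n.lt_succ_self, hzero n _ (hw n),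
          if_pos rfl, sub_zero]
      · rw [if_neg hnm.ne']
        obtain ⟨x, hx⟩ := exists_sum_fin (hAm m)
        rw [hx, map_sum]
        refine Finset.sum_eq_zero fun j _ => ?_
        rw [map_smul, map_sub, LinearMap.sub_apply, hwL n j (by omega), sub_self, smul_zero]

/-- The linear map `T` raises the position of the leading coefficient by `D`, and keeps the leading
coefficient. -/
def IsShift (b : Module.Basis ℕ K V) (D : ℕ) (T : V →ₗ[K] V) : Prop :=
  ∀ n, T (b n) ∈ lowerSpan b (n + D + 1) ∧ b.repr (T (b n)) (n + D) = 1

variable {D : ℕ} {T : V →ₗ[K] V}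

theorem IsShift.apply_mem (hT : IsShift bV D T) {n : ℕ} {v : V} (hv : v ∈ lowerSpan bV n) :
    T v ∈ lowerSpan bV (n + D) := by
  obtain ⟨x, rfl⟩ := exists_sum_fin hv
  rw [map_sum]
  refine sum_mem fun i _ => ?_
  rw [map_smul]
  exact Submodule.smul_mem _ _ (lowerSpan_mono bV (by omega) (hT i).1)

theorem IsShift.repr_apply (hT : IsShift bV D T) {n : ℕ} {v : V} (hv : v ∈ lowerSpan bV (n + 1)) :
    bV.repr (T v) (n + D) = bV.repr v n := by
  have hw : v - bV.repr v n • bV n ∈ lowerSpan bV n :=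
    mem_lowerSpan_of_succ
      (sub_mem hv (Submodule.smul_mem _ _ (basis_mem_lowerSpan bV n.lt_succ_self))) (by simp)
  have := hT.apply_mem hw (n + D) le_rfl
  rw [map_sub, map_smul, map_sub, map_smul, Finsupp.sub_apply, Finsupp.smul_apply, (hT n).2,
    smul_eq_mul, mul_one, sub_eq_zero] at this
  exact this

/-- A leading term of `v` at position `m` reappears in `T v` at position `m + D`, so nothing can
cancel it. -/
theorem IsShift.mem_of_apply_mem (hT : IsShift bV D T) {n : ℕ} {v : V}
    (hv : T v ∈ lowerSpan bV (n + D)) : v ∈ lowerSpan bV n := by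
  obtain ⟨m, hm⟩ := exists_mem_lowerSpan bV v
  induction m with
  | zero => exact lowerSpan_mono bV n.zero_le hm
  | succ m ih =>
    by_cases hmn : m + 1 ≤ n
    · exact lowerSpan_mono bV hmn hm
    · refine ih (mem_lowerSpan_of_succ hm ?_)
      rw [← hT.repr_apply hm]
      exact hv _ (by omega)

theorem IsShift.injective (hT : IsShift bV D T) : Function.Injective T :=
  (injective_iff_map_eq_zero T).2 fun v hv =>
    eq_zero_of_mem_lowerSpan_zero (hT.mem_of_apply_mem (by rw [hv]; exact zero_mem _))

/-- Division with remainder by `T`: subtracting a multiple of `T (bV m)` removes the term at `m +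
D`. -/
theorem IsShift.exists_eq_add (hT : IsShift bV D T) (v : V) :
    ∃ g, ∃ w ∈ lowerSpan bV D, v = T g + w := by
  obtain ⟨m, hm⟩ := exists_mem_lowerSpan bV v
  replace hm := lowerSpan_mono bV (Nat.le_add_right m D) hm
  induction m generalizing v with
  | zero => exact ⟨0, v, by simpa using hm, by simp⟩
  | succ m ih =>
    rw [show m + 1 + D = m + D + 1 by omega] at hm
    obtain ⟨g, w, hw, h⟩ := ih (v - bV.repr v (m + D) • T (bV m)) (mem_lowerSpan_of_succ
      (sub_mem hm (Submodule.smul_mem _ _ (hT m).1)) (by simp [(hT m).2]))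
    exact ⟨g + bV.repr v (m + D) • bV m, w, hw, by
      rw [map_add, map_smul, add_right_comm, ← h, sub_add_cancel]⟩

/-- As many linearly independent functionals vanishing on the range of a shift as the shift permits
cut out its range. -/
theorem IsShift.mem_range_iff (hT : IsShift bV D T) {φ : Fin D → V →ₗ[K] K}
    (hφ : LinearIndependent K φ) (hφT : ∀ u v, φ u (T v) = 0) (v : V) :
    (∀ u, φ u v = 0) ↔ v ∈ LinearMap.range T := by
  refine ⟨fun hv => ?_, by rintro ⟨g, rfl⟩ u; exact hφT u g⟩
  -- If the range were proper, a nonzero functional vanishing on it would give a linear relation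
  -- among the `φ u`.
  have hsurj : LinearMap.range (LinearMap.pi φ) = ⊤ := by
    by_contra hne
    obtain ⟨f, hf, hle⟩ := Submodule.exists_le_ker_of_lt_top _ (lt_top_iff_ne_top.2 hne)
    refine hf ?_
    have hsum : ∑ u, f (fun j => if u = j then 1 else 0) • φ u = 0 := by
      ext x
      have : f (LinearMap.pi φ x) = 0 := hle ⟨x, rfl⟩
      rw [LinearMap.pi_apply_eq_sum_univ] at this
      simpa [mul_comm] using this
    refine LinearMap.ext fun y => ?_
    rw [LinearMap.pi_apply_eq_sum_univ f y, LinearMap.zero_apply]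
    exact Finset.sum_eq_zero fun u _ => by
      rw [Fintype.linearIndependent_iff.1 hφ _ hsum u, smul_zero]
  -- The `φ u` restricted to remainders. As `φ` kills the range of `T`, `F` is still surjective;
  -- being square it is injective, so a remainder killed by every `φ u` is zero.
  let F : (Fin D → K) →ₗ[K] (Fin D → K) :=
    (LinearMap.pi φ).comp (Fintype.linearCombination K fun j : Fin D => bV j)
  have hF : Function.Surjective F := by
    intro y
    obtain ⟨x, rfl⟩ := LinearMap.range_eq_top.1 hsurj y
    obtain ⟨g, w, hw, rfl⟩ := hT.exists_eq_add x
    obtain ⟨c, rfl⟩ := exists_sum_fin hw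
    refine ⟨c, ?_⟩
    ext u
    simp [F, Fintype.linearCombination_apply, hφT]
  obtain ⟨g, w, hw, rfl⟩ := hT.exists_eq_add v
  obtain ⟨c, rfl⟩ := exists_sum_fin hw
  have hc : F c = 0 := by
    ext u
    simpa [F, Fintype.linearCombination_apply, hφT] using hv u
  rw [(injective_iff_map_eq_zero F).1 (LinearMap.injective_iff_surjective.2 hF) c hc]
  exact ⟨g, by simp⟩

/-- Existence of the Gauss-Borel factorization after composition with a shift. -/
theorem IsBiorthogonal.exists_comp_shift_iff {B : ℕ → W} {A : ℕ → V}
    (h : IsBiorthogonal bW bV L B A) (hT : IsShift bV D T) {φ : Fin D → V →ₗ[K] K}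
    (hφ : LinearIndependent K φ) (hφT : ∀ u v, φ u (T v) = 0) :
    (∃ B' A', IsBiorthogonal bW bV (L.compl₂ T) B' A') ↔
      ∀ n, (Matrix.of fun u c : Fin D => φ u (A (n + c))).det ≠ 0 := by
  rw [exists_isBiorthogonal_iff]
  refine forall_congr' fun n => ?_
  rw [ne_eq, ← Matrix.exists_mulVec_eq_zero_iff]
  have hmul (x : Fin D → K) (u : Fin D) :
      (Matrix.of fun u c : Fin D => φ u (A (n + c))).mulVec x u =
        φ u (∑ c, x c • A (n + c)) := by
    simp [Matrix.mulVec, dotProduct, mul_comm]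
  have hpair (x : Fin D → K) (j : ℕ) (hj : j < n) : L (B j) (∑ c, x c • A (n + c)) = 0 := by
    rw [map_sum]
    refine Finset.sum_eq_zero fun c _ => ?_
    rw [map_smul, h.pairing, if_neg (by omega), smul_zero]
  have hpair' (x : Fin D → K) (d : Fin D) : L (B (n + d)) (∑ c, x c • A (n + c)) = x d := by
    simp [h.pairing, Fin.val_inj]
  constructor
  · rintro H ⟨x, hx0, hx⟩
    have hmem := (hT.mem_range_iff hφ hφT (∑ c, x c • A (n + c))).1 fun u => by
      rw [← hmul, hx, Pi.zero_apply]
    obtain ⟨g, hg⟩ := hmem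
    have hgn : g ∈ lowerSpan bV n := by
      refine hT.mem_of_apply_mem ?_
      rw [hg]
      exact sum_mem fun c _ => Submodule.smul_mem _ _
        (lowerSpan_mono bV (by omega) (h.right_mem (n + c)))
    have hg0 := H g hgn <| by
      simp only [LinearMap.compl₂_apply, hg]
      exact (h.apply_eq_zero_iff n _).2 (hpair x)
    refine hx0 ?_
    ext d
    rw [← hpair' x d, ← hg, hg0]
    simp
  · intro H v hv hL
    by_contra hv0
    simp only [LinearMap.compl₂_apply] at hL
    rw [h.apply_eq_zero_iff] at hL
    -- In the expansion of `T v` in level `n + D`, the first `n` coefficients vanish by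
    -- orthogonality.
    have hTv : T v = ∑ c : Fin D, L (B (n + c)) (T v) • A (n + c) := by
      conv_lhs => rw [h.expansion (hT.apply_mem hv), Finset.sum_range_add]
      rw [Finset.sum_eq_zero, zero_add, Finset.sum_range]
      intro i hi
      rw [hL i (Finset.mem_range.1 hi), zero_smul]
    refine H ⟨fun c => L (B (n + c)) (T v), fun h0 => hv0 ?_, ?_⟩
    · apply hT.injective
      rw [hTv, map_zero]
      exact Finset.sum_eq_zero fun c _ => by rw [congrFun h0 c, Pi.zero_apply, zero_smul]
    · ext u
      rw [hmul, ← hTv, hφT, Pi.zero_apply]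

end Filtration

/-! ### Jordan chains as power series, and independence of their functionals. -/

section JordanChains

variable {p : ℕ}

/-- The generating series of the entries in position `a` of a sequence of row vectors. -/
def chainSeries (v : ℕ → Fin p → ℂ) (a : Fin p) : PowerSeries ℂ := PowerSeries.mk fun k => v k a

/-- The expansion of a polynomial at `z`, as a power series. -/
def taylorSeries (z : ℂ) : ℂ[X] →+* PowerSeries ℂ :=
  (Polynomial.coeToPowerSeries.ringHom).comp (Polynomial.taylorAlgHom z : ℂ[X] →+* ℂ[X])

theorem taylorSeries_apply (z : ℂ) (f : ℂ[X]) :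
    taylorSeries z f = (Polynomial.taylor z f : PowerSeries ℂ) := rfl

theorem coeff_taylorSeries (z : ℂ) (f : ℂ[X]) (l : ℕ) :
    PowerSeries.coeff l (taylorSeries z f) =
      (l.factorial : ℂ)⁻¹ * (Polynomial.derivative^[l] f).eval z := by
  rw [taylorSeries_apply, Polynomial.coeff_coe, Polynomial.taylor_coeff,
    ← Polynomial.factorial_smul_hasseDeriv]
  have : (l.factorial : ℂ) ≠ 0 := by exact_mod_cast l.factorial_ne_zero
  simp [this]

theorem coeff_chainSeries_mul_taylorSeries (z : ℂ) (v : ℕ → Fin p → ℂ) (f : ℂ[X]) (a : Fin p)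
    (k : ℕ) : PowerSeries.coeff k (chainSeries v a * taylorSeries z f) =
      ∑ l ∈ Finset.range (k + 1),
        ((l.factorial : ℂ)⁻¹) * (v (k - l) a * (Polynomial.derivative^[l] f).eval z) := by
  rw [mul_comm, PowerSeries.coeff_mul, Finset.Nat.sum_antidiagonal_eq_sum_range_succ
    fun i j => PowerSeries.coeff i (taylorSeries z f) * PowerSeries.coeff j (chainSeries v a)]
  refine Finset.sum_congr rfl fun l _ => ?_
  rw [coeff_taylorSeries, chainSeries, PowerSeries.coeff_mk]
  ring

/-- With `v(t) = ∑ v_k t^k`, evaluation along the chain is the coefficient of `t^k` in `v(t) f(z +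
t)`. The Jordan relations then say `v(t) R(z + t) = O(t^κ)`, a property preserved by right
multiplication by columns. -/
theorem chainEval_eq_coeff (z : ℂ) (v : ℕ → Fin p → ℂ) (k : ℕ) (f : Fin p → ℂ[X]) :
    chainEval z v k f =
      PowerSeries.coeff k (∑ a, chainSeries v a * taylorSeries z (f a)) := by
  simp only [map_sum, coeff_chainSeries_mul_taylorSeries, chainEval, Finset.mul_sum]
  exact Finset.sum_comm

theorem IsJordanChain.coeff_eq_zero {R : Matrix (Fin p) (Fin p) ℂ[X]} {z : ℂ} {κ : ℕ}
    {v : ℕ → Fin p → ℂ} (h : IsJordanChain R z κ v) {k : ℕ} (hk : k < κ) (a : Fin p) :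
    PowerSeries.coeff k (∑ b, chainSeries v b * taylorSeries z (R b a)) = 0 := by
  have := congrFun (h k hk) a
  simp only [Finset.sum_apply, Pi.smul_apply, smul_eq_mul, Matrix.vecMul, dotProduct, derivEval,
    Matrix.map_apply, Pi.zero_apply, Finset.mul_sum] at this
  rw [Finset.sum_comm] at this
  simpa only [map_sum, coeff_chainSeries_mul_taylorSeries] using this

/-- Evaluation along a Jordan chain of `R` kills the columns `R g`. -/
theorem IsJordanChain.chainEval_mulVec {R : Matrix (Fin p) (Fin p) ℂ[X]} {z : ℂ} {κ : ℕ}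
    {v : ℕ → Fin p → ℂ} (h : IsJordanChain R z κ v) {k : ℕ} (hk : k < κ) (g : Fin p → ℂ[X]) :
    chainEval z v k (R.mulVec g) = 0 := by
  have e : ∑ b, chainSeries v b * taylorSeries z (R.mulVec g b) =
      ∑ a, (∑ b, chainSeries v b * taylorSeries z (R b a)) * taylorSeries z (g a) := by
    simp only [Matrix.mulVec, dotProduct, map_sum, map_mul, Finset.mul_sum, Finset.sum_mul]
    rw [Finset.sum_comm]
    simp only [mul_assoc]
  rw [chainEval_eq_coeff, e, map_sum]
  refine Finset.sum_eq_zero fun a _ => ?_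
  rw [PowerSeries.coeff_mul]
  refine Finset.sum_eq_zero fun ij hij => ?_
  have := Finset.HasAntidiagonal.mem_antidiagonal.1 hij
  rw [h.coeff_eq_zero (by omega), zero_mul]

/-- Evaluation along a sequence of row vectors, as a linear functional. -/
def chainFunctional (z : ℂ) (v : ℕ → Fin p → ℂ) (k : ℕ) : (Fin p → ℂ[X]) →ₗ[ℂ] ℂ where
  toFun := chainEval z v k
  map_add' f g := by
    simp only [chainEval_eq_coeff, Pi.add_apply, map_add, mul_add, Finset.sum_add_distrib]
  map_smul' c f := by
    simp only [chainEval, Pi.smul_apply, Polynomial.iterate_derivative_smul, Polynomial.eval_smul,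
      smul_eq_mul, Finset.mul_sum, RingHom.id_apply]
    exact Finset.sum_congr rfl fun _ _ => Finset.sum_congr rfl fun _ _ => by ring

theorem chainFunctional_apply (z : ℂ) (v : ℕ → Fin p → ℂ) (k : ℕ) (f : Fin p → ℂ[X]) :
    chainFunctional z v k f = chainEval z v k f := rfl

theorem taylorSeries_X_sub_C (z : ℂ) : taylorSeries z (Polynomial.X - Polynomial.C z) =
    PowerSeries.X := by
  simp [taylorSeries_apply]

/-- Test columns for independence: the factor `(x - z)^s` kills chain positions below `s`, and at
position `s` only the leading vector survives. -/
theorem chainEval_mul (z : ℂ) (v : ℕ → Fin p → ℂ) (k : ℕ) (s : ℕ) (Q : ℂ[X]) (w : Fin p → ℂ) :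
    chainEval z v k (fun a => (Polynomial.X - Polynomial.C z) ^ s * Q * Polynomial.C (w a)) =
      PowerSeries.coeff k (PowerSeries.X ^ s *
        ∑ a, chainSeries v a * (taylorSeries z Q * taylorSeries z (Polynomial.C (w a)))) := by
  rw [chainEval_eq_coeff, Finset.mul_sum]
  simp only [map_mul, map_pow, taylorSeries_X_sub_C]
  congr 1
  exact Finset.sum_congr rfl fun a _ => by ring

theorem chainEval_mul_of_lt (z : ℂ) (v : ℕ → Fin p → ℂ) {k s : ℕ} (h : k < s) (Q : ℂ[X])
    (w : Fin p → ℂ) :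
    chainEval z v k (fun a => (Polynomial.X - Polynomial.C z) ^ s * Q * Polynomial.C (w a)) =
      0 := by
  rw [chainEval_mul, PowerSeries.coeff_X_pow_mul', if_neg (by omega)]

theorem chainEval_mul_self (z : ℂ) (v : ℕ → Fin p → ℂ) (k : ℕ) (Q : ℂ[X])
    (w : Fin p → ℂ) :
    chainEval z v k (fun a => (Polynomial.X - Polynomial.C z) ^ k * Q * Polynomial.C (w a)) =
      Q.eval z * ∑ a, v 0 a * w a := by
  rw [chainEval_mul, PowerSeries.coeff_X_pow_mul', if_pos le_rfl, Nat.sub_self, map_sum,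
    Finset.mul_sum]
  refine Finset.sum_congr rfl fun a _ => ?_
  simp only [PowerSeries.coeff_zero_eq_constantCoeff, map_mul]
  simp only [← PowerSeries.coeff_zero_eq_constantCoeff_apply, coeff_taylorSeries, chainSeries]
  simp
  ring

variable {J : ChainSystem p}

/-- The functionals of a system of chains at distinct points, with linearly independent leading
vectors at each point, are linearly independent. -/
theorem ChainSystem.linearIndependent_chainFunctional (hinj : Function.Injective J.point)
    (hlin : ∀ i, LinearIndependent ℂ fun j => J.vec i j 0) :
    LinearIndependent ℂ
      fun w : (i : Fin J.numPoints) × (j : Fin (J.numChains i)) × Fin (J.len i j) =>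
        chainFunctional (J.point w.1) (J.vec w.1 w.2.1) w.2.2 := by
  rw [Fintype.linearIndependent_iff]
  intro c hc
  obtain ⟨M, hM⟩ : ∃ M, ∀ i j, J.len i j ≤ M :=
    ⟨∑ i, ∑ j, J.len i j, fun i j => (Finset.single_le_sum (f := fun j => J.len i j)
      (fun _ _ => Nat.zero_le _) (Finset.mem_univ j)).trans
        (Finset.single_le_sum (f := fun i => ∑ j, J.len i j)
          (fun _ _ => Nat.zero_le _) (Finset.mem_univ i))⟩
  -- Descending induction on the chain position: step `n` treats all positions `k ≥ M - n`, at one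
  -- point but for all its chains at once.
  have key (i : Fin J.numPoints) (n : ℕ) : ∀ (j : Fin (J.numChains i)) (k : Fin (J.len i j)),
      M ≤ k + n → c ⟨i, j, k⟩ = 0 := by
    induction n with
    | zero => exact fun j k hk => absurd (hM i j) (by omega)
    | succ n ih =>
      intro j₀ k₀ hk₀
      by_cases hk : M ≤ k₀ + n
      · exact ih j₀ k₀ hk
      obtain ⟨s, hs⟩ : ∃ s, s = (k₀ : ℕ) := ⟨_, rfl⟩
      -- Vanishes to order `M` at every other point, which kills the chains there, and is nonzero at
      -- `point i`.
      set Q : ℂ[X] := ∏ i' ∈ Finset.univ.erase i,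
        (Polynomial.X - Polynomial.C (J.point i')) ^ M with hQ
      have hQ0 : Q.eval (J.point i) ≠ 0 := by
        rw [hQ, Polynomial.eval_prod, Finset.prod_ne_zero_iff]
        intro i' hi'
        simp only [Polynomial.eval_pow, Polynomial.eval_sub, Polynomial.eval_X, Polynomial.eval_C]
        exact pow_ne_zero _ (sub_ne_zero.2 fun h => (Finset.mem_erase.1 hi').1 (hinj h).symm)
      -- The coefficients at position `s`, with `0` for chains too short to have one. Testing
      -- against every vector `w` gives a relation among leading vectors.
      let d (j : Fin (J.numChains i)) : ℂ := if h : s < J.len i j then c ⟨i, j, s, h⟩ else 0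
      have hd : ∑ j, d j • J.vec i j 0 = 0 := by
        refine dotProduct_eq_zero _ fun w => ?_
        have hw := LinearMap.congr_fun hc fun a =>
          (Polynomial.X - Polynomial.C (J.point i)) ^ s * Q * Polynomial.C (w a)
        rw [LinearMap.sum_apply, Fintype.sum_sigma, Finset.sum_eq_single i, Fintype.sum_sigma]
          at hw
        · have hj (j : Fin (J.numChains i)) : (∑ k : Fin (J.len i j),
              (c ⟨i, j, k⟩ • chainFunctional (J.point i) (J.vec i j) k) fun a =>
                (Polynomial.X - Polynomial.C (J.point i)) ^ s * Q * Polynomial.C (w a)) =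
              Q.eval (J.point i) * (d j * ∑ a, J.vec i j 0 a * w a) := by
            by_cases hj : s < J.len i j
            · rw [Finset.sum_eq_single ⟨s, hj⟩]
              · rw [LinearMap.smul_apply, chainFunctional_apply, chainEval_mul_self]
                simp only [d, hj, dif_pos, smul_eq_mul]
                ring
              · intro k _ hks
                have hks' : (k : ℕ) ≠ s := fun h => hks (Fin.ext h)
                rcases lt_or_gt_of_ne hks' with h | h
                · rw [LinearMap.smul_apply, chainFunctional_apply, chainEval_mul_of_lt _ _ h,
                    smul_zero]
                · rw [ih j k (by omega), zero_smul, LinearMap.zero_apply]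
              · simp
            · rw [Finset.sum_eq_zero]
              · simp [d, hj]
              · intro k _
                rw [LinearMap.smul_apply, chainFunctional_apply,
                  chainEval_mul_of_lt _ _ (by omega), smul_zero]
          rw [Finset.sum_congr rfl fun j _ => hj j, ← Finset.mul_sum, LinearMap.zero_apply] at hw
          have := (mul_eq_zero.1 hw).resolve_left hQ0
          rw [← this]
          simp only [dotProduct, Finset.sum_apply, Pi.smul_apply, smul_eq_mul, Finset.sum_mul,
            Finset.mul_sum, mul_assoc]
          exact Finset.sum_comm
        · intro i' _ hi'
          rw [Fintype.sum_sigma]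
          refine Finset.sum_eq_zero fun j _ => Finset.sum_eq_zero fun k _ => ?_
          have hfac : (fun a => (Polynomial.X - Polynomial.C (J.point i)) ^ s * Q *
              Polynomial.C (w a)) = fun a => (Polynomial.X - Polynomial.C (J.point i')) ^ M *
              ((Polynomial.X - Polynomial.C (J.point i)) ^ s *
                ∏ l ∈ (Finset.univ.erase i).erase i',
                  (Polynomial.X - Polynomial.C (J.point l)) ^ M) * Polynomial.C (w a) := by
            ext1 a
            rw [hQ, ← Finset.mul_prod_erase _ _ (Finset.mem_erase.2 ⟨hi', Finset.mem_univ _⟩)]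
            ring
          rw [hfac, LinearMap.smul_apply, chainFunctional_apply,
            chainEval_mul_of_lt _ _ (lt_of_lt_of_le k.2 (hM i' j)), smul_zero]
        · simp
      have := Fintype.linearIndependent_iff.1 (hlin i) d hd j₀
      simpa [d, hs] using this
  exact fun ⟨i, j, k⟩ => key i M j k (Nat.le_add_left _ _)

/-- The total length of a canonical system of chains is the degree of the determinant. -/
theorem ChainSystem.IsCanonical.size_eq {R : Matrix (Fin p) (Fin p) ℂ[X]} (hJ : J.IsCanonical R)
    (hR : R.det ≠ 0) : J.size = R.det.natDegree := by
  have himg : Finset.univ.image J.point = R.det.roots.toFinset := by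
    ext z
    simp [hR, ← hJ.isRoot_iff]
  rw [ChainSystem.size, Finset.sum_congr rfl fun i _ => hJ.sum_len i,
    ← IsAlgClosed.card_roots_eq_natDegree, ← Multiset.toFinset_sum_count_eq, ← himg,
    Finset.sum_image hJ.point_injective.injOn]
  simp

end JordanChains

/-! ### Columns of polynomials as a filtered space. -/

section PolynomialColumns

variable {p q : ℕ}

/-- The basis `(e_1, …, e_p, x e_1, …, x e_p, x² e_1, …)` of the space of columns of polynomials. -/
def columnBasis (p : ℕ) [NeZero p] : Module.Basis ℕ ℂ (Fin p → ℂ[X]) :=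
  (Pi.basis fun _ : Fin p => Polynomial.basisMonomials ℂ).reindex
    (((Equiv.sigmaEquivProd (Fin p) ℕ).trans (Equiv.prodComm _ _)).trans (Nat.divModEquiv p).symm)

theorem columnBasis_repr [NeZero p] (f : Fin p → ℂ[X]) (k : ℕ) (a : Fin p) :
    (columnBasis p).repr f (k * p + a) = (f a).coeff k := by
  have h : Nat.divModEquiv p (k * p + a) = (k, a) := by
    rw [← Equiv.eq_symm_apply, Nat.divModEquiv_symm_apply]
  rw [columnBasis, Module.Basis.repr_reindex_apply]
  simp only [Equiv.symm_trans_apply, Equiv.symm_symm, h]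
  rfl

theorem columnBasis_apply [NeZero p] (k : ℕ) (a : Fin p) :
    columnBasis p (k * p + a) = Pi.single a (Polynomial.X ^ k) := by
  have h : Nat.divModEquiv p (k * p + a) = (k, a) := by
    rw [← Equiv.eq_symm_apply, Nat.divModEquiv_symm_apply]
  rw [columnBasis, Module.Basis.reindex_apply]
  simp only [Equiv.symm_trans_apply, Equiv.symm_symm, h]
  simp [Polynomial.X_pow_eq_monomial]

theorem exists_eq_mul_add (p : ℕ) [NeZero p] (n : ℕ) : ∃ (k : ℕ) (a : Fin p), n = k * p + a :=
  ⟨n / p, Fin.ofNat p n, by simp [Fin.ofNat, Nat.div_add_mod']⟩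

theorem mem_lowerSpan_columnBasis [NeZero p] {f : Fin p → ℂ[X]} {n : ℕ} :
    f ∈ lowerSpan (columnBasis p) n ↔
      ∀ (a : Fin p) (k : ℕ), n ≤ k * p + a → (f a).coeff k = 0 := by
  refine ⟨fun h a k hk => by rw [← columnBasis_repr]; exact h _ hk, fun h m hm => ?_⟩
  obtain ⟨k, a, rfl⟩ := exists_eq_mul_add p m
  rw [columnBasis_repr, h a k hm]

theorem isMixedOrthogonal_iff [NeZero p] [NeZero q] {μ : MeasureMatrix q p}
    (hμ : HasFiniteMoments μ) {B : ℕ → Fin q → ℂ[X]} {A : ℕ → Fin p → ℂ[X]} :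
    IsMixedOrthogonal μ B A ↔
      IsBiorthogonal (columnBasis q) (columnBasis p) (momentPairing hμ) B A := by
  constructor
  · intro h
    refine ⟨fun n => mem_lowerSpan_columnBasis.2 (h.B_coeff_eq_zero n), fun n => ?_,
      fun n => mem_lowerSpan_columnBasis.2 (h.A_coeff_eq_zero n), fun n => ?_, h.biorthogonal⟩
    · obtain ⟨k, a, rfl⟩ := exists_eq_mul_add q n
      rw [columnBasis_repr, h.B_coeff_eq_one _ a k rfl]
    · obtain ⟨k, a, rfl⟩ := exists_eq_mul_add p n
      rw [columnBasis_repr]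
      exact h.A_coeff_ne_zero _ a k rfl
  · intro h
    refine ⟨fun n => mem_lowerSpan_columnBasis.1 (h.left_mem n), fun n b k hn => ?_,
      fun n => mem_lowerSpan_columnBasis.1 (h.right_mem n), fun n a k hn => ?_, h.pairing⟩
    · rw [← columnBasis_repr, ← hn, h.left_diag]
    · rw [← columnBasis_repr, ← hn]
      exact h.right_diag n

/-- For `q = 0` the pairing is an empty sum and cannot equal `1`. -/
theorem IsMixedOrthogonal.neZero {μ : MeasureMatrix q p} {B : ℕ → Fin q → ℂ[X]}
    {A : ℕ → Fin p → ℂ[X]} (h : IsMixedOrthogonal μ B A) : NeZero q := by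
  refine ⟨?_⟩
  rintro rfl
  simpa using h.biorthogonal 0 0

end PolynomialColumns

/-! ### Leading behaviour of `R` and the degree of its determinant. -/

section Perturbation

variable {p N r : ℕ} {R : Matrix (Fin p) (Fin p) ℂ[X]}

/-- Multiplication by `R` moves the leading coefficient of a column by `N p - r` positions. -/
theorem IsPerturbation.isShift [NeZero p] (hR : IsPerturbation N r R) (hN : 1 ≤ N) (hr : r < p) :
    IsShift (columnBasis p) (N * p - r) (mulColumn R) := by
  obtain ⟨M, rfl⟩ : ∃ M, N = M + 1 := ⟨N - 1, by omega⟩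
  intro n
  obtain ⟨k, a, rfl⟩ := exists_eq_mul_add p n
  have hcoeff (i : Fin p) (l : ℕ) : (mulColumn R (columnBasis p (k * p + a)) i).coeff l =
      if k ≤ l then (R i a).coeff (l - k) else 0 := by
    rw [columnBasis_apply, mulColumn_apply, Matrix.mulVec_single]
    simp [Polynomial.coeff_mul_X_pow']
  -- For `a ≥ r` the leading entry is the `1` of `R_N` in row `a - r`; for `a < r` that column of
  -- `R_N` is zero and the `1` of `R_{N-1}` in row `a + (p - r)` takes over. Both sit `N p - r`
  -- positions further on.
  have hD : (M + 1) * p - r = M * p + (p - r) := by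
    rw [add_mul, one_mul]
    omega
  have hi (i : Fin p) := i.2
  have hlead (i : Fin p) (l : ℕ) (hl : l = k + M + 1) :
      (mulColumn R (columnBasis p (k * p + a)) i).coeff l = if (a : ℕ) = i + r then 1 else 0 := by
    rw [hcoeff, if_pos (by omega), ← hR.leading, hl]
    congr 1
    omega
  have hsub (i : Fin p) (l : ℕ) (hl : l = k + M) (h1 : p - r ≤ (i : ℕ)) (h2 : (a : ℕ) < r) :
      (mulColumn R (columnBasis p (k * p + a)) i).coeff l =
        if (i : ℕ) = a + (p - r) then 1 else 0 := by
    rw [hcoeff, if_pos (by omega), ← hR.subleading i a h1 h2, hl]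
    congr 1
    omega
  rw [hD]
  have e0 : (k + M) * p = k * p + M * p := by ring
  have e1 : (k + M + 1) * p = k * p + M * p + p := by ring
  have e2 : (k + M + 2) * p = k * p + M * p + p + p := by ring
  constructor
  · refine mem_lowerSpan_columnBasis.2 fun i l hl => ?_
    rcases lt_trichotomy l (k + M) with h | h | h
    · have : (l + 1) * p ≤ (k + M) * p := Nat.mul_le_mul_right p h
      rw [add_mul, one_mul] at this
      have := hi i
      omega
    -- Lying beyond position `n + D` at this degree forces `i > a + (p - r)`, hence `a < r`: the
    -- prescribed block of `R_{N-1}`, off its diagonal.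
    · have := hi i
      rw [h, e0] at hl
      rw [hsub i l h (by omega) (by omega), if_neg (by omega)]
    · rcases Nat.eq_or_lt_of_le h with h' | h'
      · rw [← h', Nat.succ_eq_add_one, e1] at hl
        rw [hlead i l h'.symm, if_neg (by omega)]
      · rw [hcoeff, if_pos (by omega)]
        exact Polynomial.coeff_eq_zero_of_natDegree_lt
          ((hR.natDegree_le i a).trans_lt (by omega))
  · obtain ⟨l, i, hl⟩ := exists_eq_mul_add p (k * p + a + (M * p + (p - r)))
    rw [hl, columnBasis_repr]
    have := hi i
    have := hi a
    rcases lt_trichotomy l (k + M) with h | h | h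
    · have : (l + 1) * p ≤ (k + M) * p := Nat.mul_le_mul_right p h
      rw [add_mul, one_mul] at this
      omega
    · rw [h, e0] at hl
      rw [hsub i l h (by omega) (by omega), if_pos (by omega)]
    · rcases Nat.eq_or_lt_of_le h with h' | h'
      · rw [← h', Nat.succ_eq_add_one, e1] at hl
        rw [hlead i l h'.symm, if_pos (by omega)]
      · have : (k + M + 2) * p ≤ l * p := Nat.mul_le_mul_right p h'
        omega

/-- Each Leibniz term is a product of `card n` entries of degree at most `N`, so its top coefficient
is the product of theirs. -/
theorem coeff_det_of_natDegree_le {n : Type*} [Fintype n] [DecidableEq n] (P : Matrix n n ℂ[X])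
    (N : ℕ) (hP : ∀ i j, (P i j).natDegree ≤ N) :
    P.det.natDegree ≤ Fintype.card n * N ∧
      P.det.coeff (Fintype.card n * N) = (P.map fun f => f.coeff N).det := by
  rw [Matrix.det_apply, Matrix.det_apply]
  constructor
  · refine Polynomial.natDegree_sum_le_of_forall_le _ _ fun σ _ => ?_
    refine (Polynomial.natDegree_smul_le _ _).trans ((Polynomial.natDegree_prod_le _ _).trans ?_)
    refine (Finset.sum_le_card_nsmul _ _ N fun i _ => hP _ _).trans ?_
    simp
  · rw [Polynomial.finsetSum_coeff]
    refine Finset.sum_congr rfl fun σ _ => ?_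
    rw [Polynomial.coeff_smul, ← Finset.card_univ,
      Polynomial.coeff_prod_of_natDegree_le _ _ _ fun i _ => hP _ _]
    simp

/-- The determinant of `R` is nonzero of degree `N p - r`. -/
theorem IsPerturbation.natDegree_det (hR : IsPerturbation N r R) (hN : 1 ≤ N) (hr : r < p) :
    R.det ≠ 0 ∧ R.det.natDegree = N * p - r := by
  have : NeZero p := ⟨by omega⟩
  -- The first `r` columns of `R` have degree at most `N - 1`; multiplying them by `x` brings the
  -- `1`s of `R_N` and `R_{N-1}` to the same degree `N`, at the cost of a factor `x^r` in the
  -- determinant.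
  let d : Fin p → ℂ[X] := fun j => if (j : ℕ) < r then Polynomial.X else 1
  let P : Matrix (Fin p) (Fin p) ℂ[X] := R * Matrix.diagonal d
  have hP (i j : Fin p) : P i j = R i j * d j := Matrix.mul_diagonal d R i j
  have hlow (i j : Fin p) (hj : (j : ℕ) < r) : (R i j).natDegree ≤ N - 1 := by
    refine Polynomial.natDegree_le_iff_coeff_eq_zero.2 fun m hm => ?_
    rcases Nat.eq_or_lt_of_le (show N ≤ m by omega) with rfl | h
    · rw [hR.leading, if_neg (by omega)]
    · exact Polynomial.coeff_eq_zero_of_natDegree_lt ((hR.natDegree_le i j).trans_lt h)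
  have hPdeg (i j : Fin p) : (P i j).natDegree ≤ N := by
    rw [hP]
    by_cases hj : (j : ℕ) < r
    · simp only [d, hj, if_true]
      refine Polynomial.natDegree_mul_le.trans ?_
      have := hlow i j hj
      rw [Polynomial.natDegree_X]
      omega
    · simpa [d, hj] using hR.natDegree_le i j
  have hPcoeff (i j : Fin p) :
      (P i j).coeff N = if (j : ℕ) < r then (R i j).coeff (N - 1) else (R i j).coeff N := by
    rw [hP]
    by_cases hj : (j : ℕ) < r
    · obtain ⟨M, rfl⟩ : ∃ M, N = M + 1 := ⟨N - 1, by omega⟩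
      simp [d, hj]
    · simp [d, hj]
  have hdetP : P.det = R.det * Polynomial.X ^ r := by
    rw [Matrix.det_mul, Matrix.det_diagonal, Finset.prod_ite, Finset.prod_const,
      Finset.prod_const_one, mul_one]
    congr 2
    rw [Fin.card_filter_val_lt, min_eq_right hr.le]
  have hlead : P.det.coeff (p * N) ≠ 0 := by
    have h := (coeff_det_of_natDegree_le P N hPdeg).2
    rw [Fintype.card_fin] at h
    rw [h]
    set C : Matrix (Fin p) (Fin p) ℂ := P.map fun f => f.coeff N with hC
    -- The cyclic shift of columns that moves both identity blocks onto the diagonal; the arbitrary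
    -- block of `R_{N-1}` lands strictly above it.
    let σ : Equiv.Perm (Fin p) := Equiv.addRight ⟨r, hr⟩
    have hσ (j : Fin p) : (σ j : ℕ) = if (j : ℕ) < p - r then (j : ℕ) + r else j - (p - r) := by
      have hj := j.2
      simp only [σ, Equiv.coe_addRight, Fin.val_add]
      split_ifs with h
      · exact Nat.mod_eq_of_lt (by omega)
      · rw [Nat.mod_eq_sub_mod (by omega), Nat.mod_eq_of_lt (by omega)]
        omega
    have hent (i j : Fin p) (hij : j ≤ i) : C i (σ j) = if i = j then 1 else 0 := by
      have hj := j.2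
      rw [Fin.le_def] at hij
      simp only [hC, Matrix.map_apply, hPcoeff, Fin.ext_iff]
      by_cases h : (j : ℕ) < p - r
      · rw [if_neg (by rw [hσ, if_pos h]; omega), hR.leading, hσ, if_pos h]
        congr 1
        exact propext (by omega)
      · rw [if_pos (by rw [hσ, if_neg h]; omega),
          hR.subleading _ _ (by omega) (by rw [hσ, if_neg h]; omega), hσ, if_neg h]
        congr 1
        exact propext (by omega)
    have htri : (C.submatrix id σ).det = 1 := by
      rw [Matrix.det_of_isUpperTriangular fun i j hij => ?_]
      · exact Finset.prod_eq_one fun i _ => by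
          rw [Matrix.submatrix_apply, id, hent i i le_rfl, if_pos rfl]
      · rw [Matrix.submatrix_apply, id, hent i j (le_of_lt hij), if_neg (show i ≠ j from ne_of_gt hij)]
    rw [Matrix.det_permute'] at htri
    exact right_ne_zero_of_mul (htri ▸ one_ne_zero)
  have hdegP : P.det.natDegree = p * N :=
    le_antisymm (by simpa using (coeff_det_of_natDegree_le P N hPdeg).1)
      (Polynomial.le_natDegree_of_ne_zero hlead)
  have hR0 : R.det ≠ 0 := by
    intro h
    rw [hdetP, h, zero_mul] at hlead
    simp at hlead
  refine ⟨hR0, ?_⟩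
  rw [hdetP, Polynomial.natDegree_mul_X_pow _ hR0] at hdegP
  rw [mul_comm N p]
  omega

end Perturbation

end MixedMOP

end


/-! ### The theorem. -/

theorem theorem4 {q p : ℕ} (μ : MixedMOP.MeasureMatrix q p)
    (hμ : MixedMOP.HasFiniteMoments μ)
    (B : ℕ → Fin q → ℂ[X]) (A : ℕ → Fin p → ℂ[X])
    (hBA : MixedMOP.IsMixedOrthogonal μ B A)
    (N r : ℕ) (hN : 1 ≤ N) (hr : r < p)
    (R : Matrix (Fin p) (Fin p) ℂ[X]) (hR : MixedMOP.IsPerturbation N r R)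
    (J : MixedMOP.ChainSystem p) (hJ : J.IsCanonical R) :
    MixedMOP.HasMixedOrthogonality (MixedMOP.perturb μ R) ↔
      ∀ n : ℕ, MixedMOP.tau A J n ≠ 0 := by
  have : NeZero p := ⟨by omega⟩
  have : NeZero q := hBA.neZero
  have hT := hR.isShift hN hr
  -- The size of the shift must equal the number of chain functionals; both are the degree of `det
  -- R`.
  rw [← (hR.natDegree_det hN hr).2, ← hJ.size_eq (hR.natDegree_det hN hr).1] at hT
  rw [MixedMOP.isMixedOrthogonal_iff hμ] at hBA
  have hφ := (MixedMOP.ChainSystem.linearIndependent_chainFunctional hJ.point_injective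
    hJ.linearIndependent).comp _ J.enum.symm.injective
  refine Iff.trans ?_ (hBA.exists_comp_shift_iff hT hφ fun u g =>
    (hJ.isJordanChain _ _).chainEval_mulVec (J.enum.symm u).2.2.2 g)
  rw [MixedMOP.HasMixedOrthogonality, and_iff_right (hμ.perturb R),
    ← MixedMOP.momentPairing_perturb hμ R]
  simp only [MixedMOP.isMixedOrthogonal_iff (hμ.perturb R)]
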